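/- Let $\mathbb{D}=\{z\in\mathbb{C}:|z|<1\}$ and $\mathbb{T}=\partial\mathbb{D}$. A majorant is a continuous increasing (not necessarily strictly) function $\omega:[0,\infty)\to[0,\infty)$ with $\omega(0)=0$ and $\omega(t)>0$ for $t>0$, such that $\omega(t)/t$ is non-increasing on $(0,\infty)$. For a majorant $\omega$, $\mathscr{L}_{\omega}(\mathbb{T})$ denotes the set of functions $h:\mathbb{T}\to\mathbb{C}$ for which there is a constant $M>0$ with $|h(\zeta_1)-h(\zeta_2)|\le M\omega(|\zeta_1-\zeta_2|)$ for all $\zeta_1,\zeta_2\in\mathbb{T}$. **Theorem 2.** Let $\omega_1$ be a majorant, and let $\omega_2$ be a majorant for which there is a constant $M>0$ such that $$\lambda\int_{\lambda}^{\pi}\frac{\omega_2(t)}{t^2}\,dt\le M\omega_2(\lambda)\qquad\text{for all }\lambda\in(0,\pi].$$ Let $g\in C(\overline{\mathbb{D}})$ and $\varphi,\psi:\mathbb{T}\to\mathbb{C}$ be complex-valued functions, and put $\varphi_1(e^{it})=\varphi(e^{it})e^{-it}$ for $t\in[0,2\pi]$. Suppose that $\varphi_1\in\mathscr{L}_{\omega_1}(\mathbb{T})$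 and $\psi\in\mathscr{L}_{\omega_2}(\mathbb{T})$, and that the complex-valued function $f\in C^4(\mathbb{D})$ satisfies $$\Delta(\Delta f)=g\ \text{ in }\mathbb{D},\qquad \partial_{\overline z}f=\varphi\ \text{ on }\mathbb{T},\qquad f=\psi\ \text{ on }\mathbb{T},$$ where $\partial_{\overline z}=\frac12\left(\frac{\partial}{\partial x}+i\frac{\partial}{\partial y}\right)$ and the boundary conditions mean that $\partial_{\overline z}f(z)\to\varphi(\zeta)$ and $f(z)\to\psi(\zeta)$ as $z\to\zeta$, $z\in\mathbb{D}$, for every $\zeta\in\mathbb{T}$. Then there is a constant $M>0$ such that, for all $z_1,z_2\in\mathbb{D}$, $$|f(z_1)-f(z_2)|\le M\omega_1(|z_1-z_2|)+M\omega_2(|z_1-z_2|).$$ -/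

import Mathlib

open Set Filter Topology Metric
open scoped Laplacian InnerProductSpace

namespace Biharmonic

/-- A majorant: a continuous increasing function `ω : [0, ∞) → [0, ∞)` with `ω 0 = 0`, not
vanishing on `(0, ∞)`, such that `ω t / t` is non-increasing on `(0, ∞)`. Only the values of `ω`
on `[0, ∞)` matter. (Monotonicity is not required to be strict; given the other conditions,
positivity on `(0, ∞)` only excludes `ω = 0`.) -/
structure IsMajorant (ω : ℝ → ℝ) : Prop where
  continuousOn : ContinuousOn ω (Ici 0)
  monotoneOn : MonotoneOn ω (Ici 0)
  map_zero : ω 0 = 0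
  pos : ∀ t, 0 < t → 0 < ω t
  antitoneOn_div : AntitoneOn (fun t => ω t / t) (Ioi 0)

/-- There is `M > 0` with `l * ∫_l^π ω(t) / t² dt ≤ M * ω(l)` for all `l ∈ (0, π]`. -/
def HardyLittlewoodCondition (ω : ℝ → ℝ) : Prop :=
  ∃ M : ℝ, 0 < M ∧ ∀ l ∈ Ioc (0 : ℝ) Real.pi,
    l * (∫ t in l..Real.pi, ω t / t ^ 2) ≤ M * ω l

/-- The Lipschitz space `L_ω(Ω)`: functions `h` with `|h z₁ - h z₂| ≤ M * ω |z₁ - z₂|` for all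
`z₁, z₂ ∈ Ω`, for some `M > 0`. -/
def lipschitzSpace (ω : ℝ → ℝ) (Ω : Set ℂ) : Set (ℂ → ℂ) :=
  {h | ∃ M : ℝ, 0 < M ∧ ∀ z₁ ∈ Ω, ∀ z₂ ∈ Ω, ‖h z₁ - h z₂‖ ≤ M * ω ‖z₁ - z₂‖}

/-- The operator `∂/∂z̄ = (∂/∂x + i ∂/∂y) / 2`. -/
noncomputable def dbar (f : ℂ → ℂ) (z : ℂ) : ℂ :=
  (1 / 2 : ℂ) * (fderiv ℝ f z 1 + Complex.I * fderiv ℝ f z Complex.I)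

/-- The function `h`, defined on the open unit disk, takes the boundary values `b` on the unit
circle: `h z → b ζ` as `z → ζ` within the disk, for every `ζ` with `|ζ| = 1`. -/
def HasBoundaryValues (h b : ℂ → ℂ) : Prop :=
  ∀ ζ ∈ sphere (0 : ℂ) 1, Tendsto h (𝓝[ball (0 : ℂ) 1] ζ) (𝓝 (b ζ))

/-- `f ∈ C⁴(𝔻)` solves `Δ(Δ f) = g` in the unit disk, with `∂f/∂z̄ = φ` and `f = ψ` on the unit
circle. -/
structure IsSolution (g φ ψ f : ℂ → ℂ) : Prop where
  contDiffOn : ContDiffOn ℝ 4 f (ball (0 : ℂ) 1)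
  equation : ∀ z ∈ ball (0 : ℂ) 1, Δ (Δ f) z = g z
  boundary_dbar : HasBoundaryValues (dbar f) φ
  boundary_value : HasBoundaryValues f ψ

end Biharmonic

namespace Biharmonic

open MeasureTheory Real

namespace IsMajorant

variable {ω : ℝ → ℝ}

lemma nonneg (hω : IsMajorant ω) {t : ℝ} (ht : 0 ≤ t) : 0 ≤ ω t := by
  rcases ht.eq_or_lt with rfl | h
  · exact hω.map_zero.ge
  · exact (hω.pos t h).le

lemma mono (hω : IsMajorant ω) {s t : ℝ} (hs : 0 ≤ s) (hst : s ≤ t) : ω s ≤ ω t :=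
  hω.monotoneOn (mem_Ici.2 hs) (mem_Ici.2 (hs.trans hst)) hst

lemma mul_le_mul_of_le (hω : IsMajorant ω) {s t : ℝ} (hs : 0 < s) (hst : s ≤ t) :
    s * ω t ≤ t * ω s := by
  have h := hω.antitoneOn_div (mem_Ioi.2 hs) (mem_Ioi.2 (hs.trans_le hst)) hst
  simp only at h
  rw [div_le_div_iff₀ (hs.trans_le hst) hs] at h
  linarith

lemma map_mul_le (hω : IsMajorant ω) {k t : ℝ} (hk : 1 ≤ k) (ht : 0 ≤ t) :
    ω (k * t) ≤ k * ω t := by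
  rcases ht.eq_or_lt with rfl | h
  · simp [hω.map_zero]
  · have := hω.mul_le_mul_of_le h (le_mul_of_one_le_left ht hk)
    have h2 : t * ω (k * t) ≤ t * (k * ω t) := by linarith
    exact le_of_mul_le_mul_left h2 h

lemma continuousOn_div_sq (hω : IsMajorant ω) {a b : ℝ} (ha : 0 < a) :
    ContinuousOn (fun t => ω t / t ^ 2) (Icc a b) := by
  refine (hω.continuousOn.mono fun x hx => mem_Ici.2 (ha.le.trans hx.1)).div (by fun_prop) ?_
  intro x hx
  have : 0 < x := ha.trans_le hx.1
  positivity

lemma integral_div_sq_mono (hω : IsMajorant ω) {a b c : ℝ} (ha : 0 < a) (hab : a ≤ b)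
    (hbc : b ≤ c) : ∫ t in a..b, ω t / t ^ 2 ≤ ∫ t in a..c, ω t / t ^ 2 := by
  refine intervalIntegral.integral_mono_interval le_rfl hab hbc ?_ ?_
  · filter_upwards [ae_restrict_mem measurableSet_Ioc] with t ht
    exact div_nonneg (hω.nonneg (ha.trans ht.1).le) (sq_nonneg t)
  · refine ContinuousOn.intervalIntegrable ?_
    rw [uIcc_of_le (hab.trans hbc)]
    exact hω.continuousOn_div_sq ha

/-- Under the Hardy–Littlewood condition, `ω t / t` grows at least logarithmically as `t`
decreases. -/
lemma mul_log_mul_le (hω : IsMajorant ω) {M : ℝ}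
    (hM : ∀ l ∈ Ioc (0 : ℝ) π, l * (∫ t in l..π, ω t / t ^ 2) ≤ M * ω l)
    {θ r : ℝ} (hθ : 0 < θ) (hθ1 : θ ≤ 1) (hr : 0 < r) (hrπ : r ≤ π) :
    θ * log (1 / θ) * ω r ≤ M * ω (θ * r) := by
  have hθr : 0 < θ * r := mul_pos hθ hr
  have hle : θ * r ≤ r := mul_le_of_le_one_left hr.le hθ1
  refine le_trans ?_ (hM (θ * r) ⟨hθr, hle.trans hrπ⟩)
  have h0 : (0 : ℝ) ∉ uIcc (θ * r) r := by
    rw [uIcc_of_le hle]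
    exact fun h => absurd h.1 (not_le.2 hθr)
  have h1 : ∫ t in (θ * r)..r, ω r / r * t⁻¹ ≤ ∫ t in (θ * r)..r, ω t / t ^ 2 := by
    refine intervalIntegral.integral_mono_on hle ?_ ?_ ?_
    · exact (intervalIntegral.intervalIntegrable_inv (fun x hx h => h0 (h ▸ hx))
        continuousOn_id).const_mul _
    · refine ContinuousOn.intervalIntegrable ?_
      rw [uIcc_of_le hle]
      exact hω.continuousOn_div_sq hθr
    · intro t ht
      have ht0 : 0 < t := hθr.trans_le ht.1
      have := hω.mul_le_mul_of_le ht0 ht.2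
      rw [← div_eq_mul_inv, div_div, div_le_div_iff₀ (by positivity) (by positivity)]
      nlinarith
  rw [intervalIntegral.integral_const_mul, integral_inv h0] at h1
  have h2 : r / (θ * r) = 1 / θ := by field_simp
  rw [h2] at h1
  calc θ * log (1 / θ) * ω r = θ * r * (ω r / r * log (1 / θ)) := by field_simp
    _ ≤ θ * r * ∫ t in (θ * r)..π, ω t / t ^ 2 := by
      gcongr
      exact h1.trans (hω.integral_div_sq_mono hθr hle hrπ)

end IsMajorant

lemma two_mul_conj_mul_dbar (F : ℂ → ℂ) (z e : ℂ) :
    2 * starRingEnd ℂ e * dbar F z =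
      fderiv ℝ F z e + Complex.I * fderiv ℝ F z (e * Complex.I) := by
  have h : ∀ v : ℂ, fderiv ℝ F z v = v.re * fderiv ℝ F z 1 + v.im * fderiv ℝ F z Complex.I := by
    intro v
    conv_lhs => rw [show v = v.re • (1 : ℂ) + v.im • Complex.I by simp [Complex.re_add_im]]
    rw [map_add, map_smul, map_smul, Complex.real_smul, Complex.real_smul]
  rw [h e, h (e * Complex.I), dbar]
  have hc : starRingEnd ℂ e = e.re - e.im * Complex.I := by
    apply Complex.ext <;> simp
  rw [hc]
  simp only [Complex.mul_re, Complex.mul_im, Complex.I_re, Complex.I_im]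
  push_cast
  ring_nf
  simp only [Complex.I_sq]
  ring

lemma continuousOn_dbar {F : ℂ → ℂ} {s : Set ℂ} (hs : IsOpen s) (hF : ContDiffOn ℝ 1 F s) :
    ContinuousOn (dbar F) s := by
  have h := hF.continuousOn_fderiv_of_isOpen hs le_rfl
  unfold dbar
  fun_prop

lemma circleMap_mem_ball' {c : ℂ} {R r : ℝ} (hr : 0 ≤ r) (hR : r < R) (θ : ℝ) :
    circleMap c r θ ∈ ball c R := by
  simp [circleMap, abs_of_nonneg hr, hR]

lemma hasDerivAt_circleMap_radius (c : ℂ) (r θ : ℝ) :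
    HasDerivAt (fun r : ℝ => circleMap c r θ) (circleMap 0 1 θ) r := by
  have h : HasDerivAt (fun r : ℝ => (r : ℂ)) 1 r := Complex.ofRealCLM.hasDerivAt
  have := (h.mul_const (Complex.exp (θ * Complex.I))).const_add c
  simpa [circleMap] using this

lemma continuous_circleMap_uncurry (c : ℂ) :
    Continuous fun p : ℝ × ℝ => circleMap c p.1 p.2 := by
  unfold circleMap
  fun_prop

/-- The integral over `θ` of the derivative of `F` in the radial direction is given by `dbar F`. -/
lemma integral_fderiv_radial {F : ℂ → ℂ} {c : ℂ} {R r : ℝ} (hF : ContDiffOn ℝ 1 F (ball c R))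
    (hr : 0 < r) (hR : r < R) :
    ∫ θ in -π..π, fderiv ℝ F (circleMap c r θ) (circleMap 0 1 θ) =
      ∫ θ in -π..π, 2 * starRingEnd ℂ (circleMap 0 1 θ) * dbar F (circleMap c r θ) := by
  have hcont := hF.continuousOn_fderiv_of_isOpen isOpen_ball le_rfl
  have hmem : ∀ θ, circleMap c r θ ∈ ball c R := circleMap_mem_ball' hr.le hR
  have hcf : Continuous fun θ => fderiv ℝ F (circleMap c r θ) :=
    hcont.comp_continuous (continuous_circleMap c r) hmem
  have hc1 := continuous_circleMap 0 1
  have hzero : ∫ θ in -π..π, fderiv ℝ F (circleMap c r θ) (circleMap 0 r θ * Complex.I) = 0 := by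
    rw [intervalIntegral.integral_eq_sub_of_hasDerivAt (f := fun θ => F (circleMap c r θ))]
    · have : circleMap c r π = circleMap c r (-π) := by
        have := periodic_circleMap c r (-π)
        rw [← this]
        ring_nf
      simp [this]
    · intro θ _
      have hd : DifferentiableAt ℝ F (circleMap c r θ) :=
        (hF.differentiableOn one_ne_zero).differentiableAt (isOpen_ball.mem_nhds (hmem θ))
      exact hd.hasFDerivAt.comp_hasDerivAt θ (hasDerivAt_circleMap c r θ)
    · refine Continuous.intervalIntegrable ?_ _ _
      have := continuous_circleMap 0 r
      fun_prop
  have hzero' : ∫ θ in -π..π, fderiv ℝ F (circleMap c r θ) (circleMap 0 1 θ * Complex.I) = 0 := by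
    have h : ∀ θ, fderiv ℝ F (circleMap c r θ) (circleMap 0 r θ * Complex.I) =
        (r : ℂ) * fderiv ℝ F (circleMap c r θ) (circleMap 0 1 θ * Complex.I) := by
      intro θ
      rw [show circleMap 0 r θ * Complex.I = r • (circleMap 0 1 θ * Complex.I) by
        simp [circleMap]; ring, map_smul, Complex.real_smul]
    simp_rw [h] at hzero
    rw [intervalIntegral.integral_const_mul] at hzero
    exact (mul_eq_zero.1 hzero).resolve_left (by exact_mod_cast hr.ne')
  simp_rw [two_mul_conj_mul_dbar]
  rw [intervalIntegral.integral_add, intervalIntegral.integral_const_mul, hzero', mul_zero,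
    add_zero]
  · exact Continuous.intervalIntegrable (by fun_prop) _ _
  · exact Continuous.intervalIntegrable (by fun_prop) _ _

lemma hasDerivAt_integral_circleMap {F : ℂ → ℂ} {c : ℂ} {R r : ℝ}
    (hF : ContDiffOn ℝ 1 F (ball c R)) (hr : 0 < r) (hR : r < R) :
    HasDerivAt (fun r => ∫ θ in -π..π, F (circleMap c r θ))
      (∫ θ in -π..π, 2 * starRingEnd ℂ (circleMap 0 1 θ) * dbar F (circleMap c r θ)) r := by
  rw [← integral_fderiv_radial hF hr hR]
  have hcont := hF.continuousOn_fderiv_of_isOpen isOpen_ball le_rfl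
  set ρ := (r + R) / 2 with hρ
  have hρR : ρ < R := by linarith
  have hrρ : r < ρ := by linarith
  obtain ⟨C, hC⟩ := (isCompact_closedBall c ρ).exists_bound_of_continuousOn
    (hcont.mono (closedBall_subset_ball hρR))
  have hcF : ∀ x ∈ Ioo 0 ρ, Continuous fun θ => F (circleMap c x θ) := fun x hx =>
    hF.continuousOn.comp_continuous (continuous_circleMap c x)
      (circleMap_mem_ball' hx.1.le (hx.2.trans hρR))
  have hs : Ioo 0 ρ ∈ 𝓝 r := Ioo_mem_nhds hr hrρ
  refine (intervalIntegral.hasDerivAt_integral_of_dominated_loc_of_deriv_le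
    (F' := fun x θ => fderiv ℝ F (circleMap c x θ) (circleMap 0 1 θ)) (bound := fun _ => C)
    hs ?_ ?_ ?_ ?_ ?_ ?_).2
  · filter_upwards [hs] with x hx
    exact (hcF x hx).aestronglyMeasurable
  · exact (hcF r ⟨hr, hrρ⟩).intervalIntegrable _ _
  · have h1 : Continuous fun θ => fderiv ℝ F (circleMap c r θ) :=
      hcont.comp_continuous (continuous_circleMap c r) (circleMap_mem_ball' hr.le hR)
    have := continuous_circleMap 0 1
    exact Continuous.aestronglyMeasurable (by fun_prop)
  · refine ae_of_all _ fun θ _ x hx => ?_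
    refine (ContinuousLinearMap.le_opNorm _ _).trans ?_
    have h2 : ‖circleMap 0 1 θ‖ = 1 := by simp
    rw [h2, mul_one]
    exact hC _ (ball_subset_closedBall (circleMap_mem_ball' hx.1.le hx.2 θ))
  · exact intervalIntegrable_const
  · refine ae_of_all _ fun θ _ x hx => ?_
    have hd : DifferentiableAt ℝ F (circleMap c x θ) :=
      (hF.differentiableOn one_ne_zero).differentiableAt
        (isOpen_ball.mem_nhds (circleMap_mem_ball' hx.1.le (hx.2.trans hρR) θ))
    exact hd.hasFDerivAt.comp_hasDerivAt x (hasDerivAt_circleMap_radius c x θ)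

lemma continuousOn_integral_circleMap {F : ℂ → ℂ} {c : ℂ} {R : ℝ}
    (hF : ContinuousOn F (closedBall c R)) :
    ContinuousOn (fun r => ∫ θ in -π..π, F (circleMap c r θ)) (Icc 0 R) := by
  obtain ⟨C, hC⟩ := (isCompact_closedBall c R).exists_bound_of_continuousOn hF
  have hmem : ∀ r ∈ Icc 0 R, ∀ θ, circleMap c r θ ∈ closedBall c R := fun r hr θ => by
    simp [circleMap, abs_of_nonneg hr.1, hr.2]
  intro r hr
  refine intervalIntegral.continuousWithinAt_of_dominated_interval (bound := fun _ => C)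
    ?_ ?_ intervalIntegrable_const ?_
  · filter_upwards [self_mem_nhdsWithin] with x hx
    exact (hF.comp_continuous (continuous_circleMap c x) (hmem x hx)).aestronglyMeasurable
  · filter_upwards [self_mem_nhdsWithin] with x hx
    exact ae_of_all _ fun θ _ => hC _ (hmem x hx θ)
  · refine ae_of_all _ fun θ _ => ?_
    exact ContinuousWithinAt.comp (f := fun r => circleMap c r θ) (x := r) (hF _ (hmem r hr θ))
      (hasDerivAt_circleMap_radius c r θ).continuousAt.continuousWithinAt fun x hx => hmem x hx θ

/-- The circle mean of `F` differs from the value at the centre by at most the growth of `G`, when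
`G'` dominates the circle means of `2 * ‖dbar F‖`. -/
lemma norm_integral_circleMap_sub_le {F : ℂ → ℂ} {c : ℂ} {R : ℝ} (hR : 0 < R)
    (hF : ContDiffOn ℝ 1 F (ball c R)) (hFc : ContinuousOn F (closedBall c R))
    {G G' : ℝ → ℝ} (hG : ∀ r ∈ Icc 0 R, HasDerivAt G (G' r) r)
    (hFG : ∀ r ∈ Ioo 0 R, ∫ θ in -π..π, 2 * ‖dbar F (circleMap c r θ)‖ ≤ G' r) :
    ‖(∫ θ in -π..π, F (circleMap c R θ)) - 2 * π * F c‖ ≤ G R - G 0 := by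
  set m : ℝ → ℂ := fun r => ∫ θ in -π..π, F (circleMap c r θ) with hm
  have hmc : ContinuousOn m (Icc 0 R) := continuousOn_integral_circleMap hFc
  have hGc : ContinuousOn G (Icc 0 R) := fun x hx => (hG x hx).continuousAt.continuousWithinAt
  have hm0 : m 0 = 2 * π * F c := by
    simp only [hm, circleMap_zero_radius, Function.const_apply, intervalIntegral.integral_const]
    rw [Complex.real_smul]
    push_cast
    ring
  rw [← hm0]
  have hpos : ∀ ε ∈ Ioc 0 R, ‖m R - m ε‖ ≤ G R - G ε := by
    intro ε hε
    have hsub : Icc ε R ⊆ Icc 0 R := Icc_subset_Icc_left hε.1.le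
    refine image_norm_le_of_norm_deriv_right_le_deriv_boundary' (a := ε) (b := R)
      (f := fun r => m r - m ε) (B := fun r => G r - G ε)
      ((hmc.mono hsub).sub continuousOn_const) (fun x hx =>
        ((hasDerivAt_integral_circleMap hF (hε.1.trans_le hx.1) hx.2).sub_const _).hasDerivWithinAt)
      (by simp) ((hGc.mono hsub).sub continuousOn_const) (fun x hx =>
        ((hG x (hsub (Ico_subset_Icc_self hx))).sub_const _).hasDerivWithinAt) ?_
      (right_mem_Icc.2 hε.2)
    intro x hx
    refine le_trans ?_ (hFG x ⟨hε.1.trans_le hx.1, hx.2⟩)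
    refine (intervalIntegral.norm_integral_le_integral_norm (by linarith [pi_pos])).trans_eq ?_
    simp
  have hlim : ∀ {E : Type} [TopologicalSpace E] {h : ℝ → E}, ContinuousOn h (Icc 0 R) →
      Tendsto h (𝓝[>] 0) (𝓝 (h 0)) := fun hh =>
    (hh 0 (left_mem_Icc.2 hR.le)).mono_left
      (nhdsWithin_le_of_mem (mem_of_superset (Ioc_mem_nhdsGT hR) Ioc_subset_Icc_self))
  refine le_of_tendsto_of_tendsto (tendsto_const_nhds.sub (hlim hmc)).norm
    (tendsto_const_nhds.sub (hlim hGc)) ?_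
  filter_upwards [Ioc_mem_nhdsGT hR] with ε hε using hpos ε hε

lemma integral_ball_eq_integral_circleMap {F : ℂ → ℂ} {c : ℂ} {s : ℝ} (hs : 0 < s)
    (hF : ContinuousOn F (closedBall c s)) :
    ∫ w in ball c s, F w = ∫ r in 0..s, (r : ℂ) * ∫ θ in -π..π, F (circleMap c r θ) := by
  have hππ : -π ≤ π := by linarith [pi_pos]
  have h1 : ∫ w in ball c s, F w = ∫ w, (ball (0 : ℂ) s).indicator (fun w => F (c + w)) w := by
    rw [← integral_indicator measurableSet_ball, ← integral_add_left_eq_self _ c]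
    refine integral_congr_ae (ae_of_all _ fun w => ?_)
    simp [indicator]
  rw [h1, ← Complex.integral_comp_polarCoord_symm]
  have h2 : ∀ p ∈ polarCoord.target,
      p.1 • (ball (0 : ℂ) s).indicator (fun w => F (c + w)) (Complex.polarCoord.symm p) =
        (Ioo 0 s ×ˢ Ioo (-π) π).indicator (fun p => (p.1 : ℂ) * F (circleMap c p.1 p.2)) p := by
    rintro ⟨r, θ⟩ hp
    rw [polarCoord_target] at hp
    have hr : 0 < r := hp.1
    have hθ : θ ∈ Ioo (-π) π := hp.2
    have he : c + Complex.polarCoord.symm (r, θ) = circleMap c r θ := by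
      rw [Complex.polarCoord_symm_apply, circleMap, Complex.exp_mul_I]
      simp
    have hmem : Complex.polarCoord.symm (r, θ) ∈ ball (0 : ℂ) s ↔ r < s := by
      rw [mem_ball_zero_iff, Complex.norm_polarCoord_symm, abs_of_pos hr]
    by_cases hrs : r < s
    · rw [indicator_of_mem (hmem.2 hrs), indicator_of_mem (by exact ⟨⟨hr, hrs⟩, hθ⟩), he,
        Complex.real_smul]
    · rw [indicator_of_notMem (fun h => hrs (hmem.1 h)),
        indicator_of_notMem (fun h => hrs h.1.2), smul_zero]
  rw [setIntegral_congr_fun polarCoord.open_target.measurableSet h2,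
    setIntegral_indicator (measurableSet_Ioo.prod measurableSet_Ioo),
    inter_eq_self_of_subset_right (by
      rw [polarCoord_target]
      exact prod_mono Ioo_subset_Ioi_self subset_rfl),
    Measure.volume_eq_prod, setIntegral_prod]
  · rw [intervalIntegral.integral_of_le hs.le, integral_Ioc_eq_integral_Ioo]
    refine setIntegral_congr_fun measurableSet_Ioo fun r _ => ?_
    simp only
    rw [intervalIntegral.integral_of_le hππ, integral_Ioc_eq_integral_Ioo, integral_const_mul]
  · have hK : ContinuousOn (fun p : ℝ × ℝ => (p.1 : ℂ) * F (circleMap c p.1 p.2))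
        (Icc 0 s ×ˢ Icc (-π) π) := by
      refine ContinuousOn.mul (by fun_prop) ?_
      refine hF.comp (continuous_circleMap_uncurry c).continuousOn ?_
      rintro ⟨r, θ⟩ ⟨hr, -⟩
      simp [circleMap, abs_of_nonneg hr.1, hr.2]
    rw [← Measure.volume_eq_prod]
    exact (hK.integrableOn_compact (isCompact_Icc.prod isCompact_Icc)).mono_set
      (prod_mono Ioo_subset_Icc_self Ioo_subset_Icc_self)

lemma norm_integral_circleMap_sub_le_of_bound {F : ℂ → ℂ} {c : ℂ} {s B : ℝ} (hs : 0 < s)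
    (hF : ContDiffOn ℝ 1 F (ball c s)) (hFc : ContinuousOn F (closedBall c s))
    (hB : ∀ w ∈ ball c s, ‖dbar F w‖ ≤ B) :
    ‖(∫ θ in -π..π, F (circleMap c s θ)) - 2 * π * F c‖ ≤ 4 * π * B * s := by
  have := norm_integral_circleMap_sub_le hs hF hFc (G := fun r => 4 * π * B * r)
    (G' := fun _ => 4 * π * B)
    (fun r _ => by simpa using (hasDerivAt_id r).const_mul (4 * π * B)) ?_
  · simpa using this
  · intro r hr
    refine (le_abs_self _).trans ?_
    rw [← Real.norm_eq_abs]
    refine (intervalIntegral.norm_integral_le_of_norm_le_const (C := 2 * B) ?_).trans_eq ?_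
    · intro θ _
      rw [norm_mul, norm_norm, Real.norm_ofNat]
      gcongr
      exact hB _ (circleMap_mem_ball' hr.1.le hr.2 θ)
    · rw [abs_of_pos (by linarith [pi_pos])]
      ring

lemma norm_integral_ball_sub_le {F : ℂ → ℂ} {c : ℂ} {R s B : ℝ} (hs : 0 < s) (hsR : s < R)
    (hF : ContDiffOn ℝ 1 F (ball c R)) (hB : ∀ w ∈ ball c R, ‖dbar F w‖ ≤ B) :
    ‖(∫ w in ball c s, F w) - π * s ^ 2 * F c‖ ≤ 4 * π * B * s ^ 3 := by
  have hB0 : 0 ≤ B := (norm_nonneg _).trans (hB c (mem_ball_self (hs.trans hsR)))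
  have hFc : ContinuousOn F (closedBall c s) := hF.continuousOn.mono (closedBall_subset_ball hsR)
  have h1 : (π * s ^ 2 * F c : ℂ) = ∫ r in 0..s, (r : ℂ) * (2 * π * F c) := by
    rw [intervalIntegral.integral_mul_const, intervalIntegral.integral_ofReal, integral_id]
    push_cast
    ring
  have hcr : ContinuousOn (fun r : ℝ => (r : ℂ)) (uIcc 0 s) := by fun_prop
  rw [integral_ball_eq_integral_circleMap hs hFc, h1, ← intervalIntegral.integral_sub]
  · refine (intervalIntegral.norm_integral_le_of_norm_le_const (C := s * (4 * π * B * s))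
      ?_).trans_eq ?_
    · intro r hr
      rw [uIoc_of_le hs.le] at hr
      have hsub : closedBall c r ⊆ closedBall c s := closedBall_subset_closedBall hr.2
      have hsub' : ball c r ⊆ ball c R := ball_subset_ball (hr.2.trans hsR.le)
      have h2 := norm_integral_circleMap_sub_le_of_bound hr.1 (hF.mono hsub') (hFc.mono hsub)
        fun w hw => hB w (hsub' hw)
      rw [← mul_sub, norm_mul, Complex.norm_real, Real.norm_of_nonneg hr.1.le]
      have hr0 := hr.1.le
      refine mul_le_mul hr.2 (h2.trans ?_) (norm_nonneg _) hs.le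
      have := hr.2
      gcongr
    · rw [sub_zero, abs_of_pos hs]
      ring
  · refine (hcr.mul ?_).intervalIntegrable
    rw [uIcc_of_le hs.le]
    exact continuousOn_integral_circleMap hFc
  · exact (hcr.mul continuousOn_const).intervalIntegrable

lemma norm_integral_ball_sub_integral_ball_le {F : ℂ → ℂ} {z w : ℂ} {s S : ℝ} (hs : 0 < s)
    (hzw : dist z w ≤ s) (hFz : IntegrableOn F (ball z s)) (hFw : IntegrableOn F (ball w s))
    (hz : ∀ x ∈ ball z s, ‖F x‖ ≤ S) (hw : ∀ x ∈ ball w s, ‖F x‖ ≤ S) :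
    ‖(∫ x in ball z s, F x) - ∫ x in ball w s, F x‖ ≤ 4 * π * S * s * dist z w := by
  have key : ∀ a b : ℂ, dist a b ≤ s → IntegrableOn F (ball a s) → (∀ x ∈ ball a s, ‖F x‖ ≤ S) →
      ‖∫ x in ball a s \ ball b s, F x‖ ≤ 2 * π * S * s * dist a b := by
    intro a b hab hFa ha
    set t := s - dist a b with ht
    have ht0 : 0 ≤ t := sub_nonneg.2 hab
    have hts : t ≤ s := sub_le_self _ dist_nonneg
    have hsub : ball a t ⊆ ball b s := ball_subset_ball' (by rw [ht]; linarith)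
    have hS : 0 ≤ S := (norm_nonneg _).trans (ha a (mem_ball_self hs))
    have hvol : ∀ r : ℝ, 0 ≤ r → volume.real (ball a r) = π * r ^ 2 := by
      intro r hr
      rw [measureReal_def, Complex.volume_ball, ENNReal.toReal_mul, ENNReal.toReal_pow,
        ENNReal.toReal_ofReal hr, ENNReal.coe_toReal, NNReal.coe_real_pi]
      ring
    have hfin : volume (ball a s \ ball b s) ≠ ⊤ :=
      ((measure_mono sdiff_subset).trans_lt measure_ball_lt_top).ne
    refine (norm_setIntegral_le_of_norm_le_const (lt_top_iff_ne_top.2 hfin)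
      fun x hx => ha x hx.1).trans ?_
    have h1 : volume.real (ball a s \ ball b s) ≤ volume.real (ball a s \ ball a t) :=
      measureReal_mono (sdiff_subset_sdiff_right hsub)
        ((measure_mono sdiff_subset).trans_lt measure_ball_lt_top).ne
    have h2 : volume.real (ball a s \ ball a t) = π * s ^ 2 - π * t ^ 2 := by
      rw [measureReal_sdiff (ball_subset_ball hts) measurableSet_ball measure_ball_lt_top.ne,
        hvol s hs.le, hvol t ht0]
    have h3 : π * s ^ 2 - π * t ^ 2 ≤ 2 * π * s * dist a b := by
      have : dist a b = s - t := by rw [ht]; ring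
      rw [this]
      nlinarith [mul_nonneg pi_pos.le (sq_nonneg (s - t))]
    calc S * volume.real (ball a s \ ball b s) ≤ S * (2 * π * s * dist a b) := by
          gcongr
          exact h1.trans (h2.trans_le h3)
      _ = _ := by ring
  have e1 := integral_inter_add_sdiff (measurableSet_ball (x := w) (ε := s)) hFz
  have e2 := integral_inter_add_sdiff (measurableSet_ball (x := z) (ε := s)) hFw
  rw [inter_comm] at e2
  rw [← e1, ← e2, add_sub_add_left_eq_sub]
  refine (norm_sub_le _ _).trans ?_
  have k1 := key z w hzw hFz hz
  have k2 := key w z (dist_comm z w ▸ hzw) hFw hw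
  rw [dist_comm w z] at k2
  linarith

lemma dbar_sub_const (F : ℂ → ℂ) (a : ℂ) : dbar (fun x => F x - a) = dbar F := by
  ext z
  simp only [dbar, fderiv_sub_const]

/-- Interior oscillation estimate for functions with bounded `dbar F`. -/
lemma norm_sub_le_of_dbar_bound {F : ℂ → ℂ} {z w : ℂ} {R B S : ℝ} (hR : 0 < R)
    (hF : ContDiffOn ℝ 1 F (ball z R)) (hB : ∀ x ∈ ball z R, ‖dbar F x‖ ≤ B)
    (hS : ∀ x ∈ ball z R, ‖F x - F z‖ ≤ S) (hzw : dist z w ≤ R / 4) :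
    ‖F w - F z‖ ≤ 2 * B * R + 16 * S * dist z w / R := by
  set s := R / 4 with hs
  have hRs : R = 4 * s := by rw [hs]; ring
  have hs0 : 0 < s := by positivity
  have hsubw : ball w (R / 2) ⊆ ball z R := ball_subset_ball' (by rw [dist_comm]; linarith)
  have hsubz : ball z (R / 2) ⊆ ball z R := ball_subset_ball (by linarith)
  have hlt : s < R / 2 := by linarith
  set v : ℂ → ℂ := fun x => F x - F z with hv
  have hvF : ContDiffOn ℝ 1 v (ball z R) := hF.sub contDiffOn_const
  have hvB : ∀ x ∈ ball z R, ‖dbar v x‖ ≤ B := by rwa [hv, dbar_sub_const]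
  have hint : ∀ a, ball a (R / 2) ⊆ ball z R → IntegrableOn v (ball a s) := fun a ha =>
    ((hvF.continuousOn.mono ((closedBall_subset_ball hlt).trans ha)).integrableOn_compact
      (isCompact_closedBall a s)).mono_set ball_subset_closedBall
  have hsub : ∀ a, ball a (R / 2) ⊆ ball z R → ball a s ⊆ ball z R := fun a ha =>
    (ball_subset_ball hlt.le).trans ha
  have h1 := norm_integral_ball_sub_le hs0 hlt (hvF.mono hsubw) fun x hx => hvB x (hsubw hx)
  have h2 := norm_integral_ball_sub_le hs0 hlt (hvF.mono hsubz) fun x hx => hvB x (hsubz hx)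
  have h3 := norm_integral_ball_sub_integral_ball_le hs0 hzw (hint z hsubz) (hint w hsubw)
    (fun x hx => hS x (hsub z hsubz hx)) fun x hx => hS x (hsub w hsubw hx)
  have hvz : v z = 0 := sub_self _
  rw [hvz, mul_zero, sub_zero] at h2
  have h4 : ‖(π * s ^ 2 * v w : ℂ)‖ ≤ 8 * π * B * s ^ 3 + 4 * π * S * s * dist z w := by
    set Iw := ∫ x in ball w s, v x
    set Iz := ∫ x in ball z s, v x
    have : (π * s ^ 2 * v w : ℂ) = Iz - (Iw - π * s ^ 2 * v w) - (Iz - Iw) := by ring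
    rw [this]
    refine (norm_sub_le _ _).trans ?_
    have := norm_sub_le Iz (Iw - π * s ^ 2 * v w)
    linarith
  rw [norm_mul, norm_mul, norm_pow, Complex.norm_real, Complex.norm_real,
    Real.norm_of_nonneg pi_pos.le, Real.norm_of_nonneg hs0.le] at h4
  have hpos : 0 < π * s ^ 2 := by positivity
  refine le_of_mul_le_mul_left (h4.trans_eq ?_) hpos
  rw [hRs]
  field_simp
  ring

/-- For `‖ζ‖ = 1` and `0 ≤ ρ < 1`, an automorphism of the unit disk that takes `0` to `ρ * ζ`. -/
noncomputable def diskMap (ζ : ℂ) (ρ : ℝ) (w : ℂ) : ℂ := ζ * ((ρ - w) / (1 - ρ * w))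

section diskMap

variable {ζ w : ℂ} {ρ : ℝ}

lemma diskMap_zero (ζ : ℂ) (ρ : ℝ) : diskMap ζ ρ 0 = ρ * ζ := by
  simp [diskMap, mul_comm]

lemma sub_le_norm_one_sub_mul (hρ : 0 ≤ ρ) (hw : ‖w‖ ≤ 1) : 1 - ρ ≤ ‖1 - ρ * w‖ := by
  have h := norm_sub_norm_le (1 : ℂ) (ρ * w)
  rw [norm_one, norm_mul, Complex.norm_real, Real.norm_of_nonneg hρ] at h
  nlinarith

lemma one_sub_mul_ne_zero (hρ : 0 ≤ ρ) (hρ1 : ρ < 1) (hw : ‖w‖ ≤ 1) : 1 - ρ * w ≠ 0 := by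
  have := sub_le_norm_one_sub_mul hρ hw
  exact norm_pos_iff.1 (by linarith)

lemma sq_norm_one_sub_mul_sub (ρ : ℝ) (w : ℂ) :
    ‖1 - ρ * w‖ ^ 2 - ‖ρ - w‖ ^ 2 = (1 - ρ ^ 2) * (1 - ‖w‖ ^ 2) := by
  simp only [Complex.sq_norm, Complex.normSq_apply, Complex.sub_re, Complex.sub_im,
    Complex.re_ofReal_mul, Complex.im_ofReal_mul, Complex.one_re, Complex.one_im,
    Complex.ofReal_re, Complex.ofReal_im]
  ring

lemma norm_diskMap (hζ : ‖ζ‖ = 1) : ‖diskMap ζ ρ w‖ = ‖ρ - w‖ / ‖1 - ρ * w‖ := by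
  rw [diskMap, norm_mul, hζ, one_mul, norm_div]

lemma norm_diskMap_le (hζ : ‖ζ‖ = 1) (hρ : 0 ≤ ρ) (hρ1 : ρ < 1) (hw : ‖w‖ ≤ 1) :
    ‖diskMap ζ ρ w‖ ≤ 1 := by
  rw [norm_diskMap hζ, div_le_one (norm_pos_iff.2 (one_sub_mul_ne_zero hρ hρ1 hw))]
  have h := sq_norm_one_sub_mul_sub ρ w
  have h1 : 0 ≤ (1 - ρ ^ 2) * (1 - ‖w‖ ^ 2) := by
    apply mul_nonneg <;> nlinarith [norm_nonneg w]
  exact (pow_le_pow_iff_left₀ (norm_nonneg _) (norm_nonneg _) two_ne_zero).1 (by linarith)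

lemma norm_diskMap_lt (hζ : ‖ζ‖ = 1) (hρ : 0 ≤ ρ) (hρ1 : ρ < 1) (hw : ‖w‖ < 1) :
    ‖diskMap ζ ρ w‖ < 1 := by
  rw [norm_diskMap hζ, div_lt_one (norm_pos_iff.2 (one_sub_mul_ne_zero hρ hρ1 hw.le))]
  have h := sq_norm_one_sub_mul_sub ρ w
  have h1 : 0 < (1 - ρ ^ 2) * (1 - ‖w‖ ^ 2) := by
    apply mul_pos <;> nlinarith [norm_nonneg w]
  exact lt_of_pow_lt_pow_left₀ 2 (norm_nonneg _) (by linarith)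

lemma norm_diskMap_eq (hζ : ‖ζ‖ = 1) (hρ : 0 ≤ ρ) (hρ1 : ρ < 1) (hw : ‖w‖ = 1) :
    ‖diskMap ζ ρ w‖ = 1 := by
  rw [norm_diskMap hζ, div_eq_one_iff_eq (norm_ne_zero_iff.2 (one_sub_mul_ne_zero hρ hρ1 hw.le))]
  have h := sq_norm_one_sub_mul_sub ρ w
  rw [hw] at h
  exact (pow_left_inj₀ (norm_nonneg _) (norm_nonneg _) two_ne_zero).1 (by linarith)

lemma hasDerivAt_diskMap (ζ : ℂ) (hρ : 0 ≤ ρ) (hρ1 : ρ < 1) (hw : ‖w‖ ≤ 1) :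
    HasDerivAt (diskMap ζ ρ) (-ζ * (1 - ρ ^ 2) / (1 - ρ * w) ^ 2) w := by
  have hne := one_sub_mul_ne_zero hρ hρ1 hw
  have h := ((((hasDerivAt_id w).const_sub (ρ : ℂ))).div
    (((hasDerivAt_id w).const_mul (ρ : ℂ)).const_sub 1) hne).const_mul ζ
  refine h.congr_deriv ?_
  simp only [id]
  field_simp
  ring

lemma norm_diskMap_sub_le (hζ : ‖ζ‖ = 1) (hρ : 0 ≤ ρ) (hρ1 : ρ < 1) (hw : ‖w‖ ≤ 1) :
    ‖diskMap ζ ρ w - ζ‖ ≤ 2 * (1 - ρ) / ‖1 - ρ * w‖ := by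
  have hne := one_sub_mul_ne_zero hρ hρ1 hw
  have h : diskMap ζ ρ w - ζ = -ζ * (((1 - ρ : ℝ) : ℂ) * (1 + w)) / (1 - ρ * w) := by
    rw [diskMap]
    push_cast
    field_simp
    ring
  rw [h, norm_div, norm_mul, norm_neg, hζ, norm_mul, Complex.norm_real,
    Real.norm_of_nonneg (by linarith), one_mul]
  have : ‖1 + w‖ ≤ 2 := (norm_add_le _ _).trans (by rw [norm_one]; linarith)
  gcongr ?_ / _
  nlinarith

lemma abs_div_pi_le_norm_one_sub_mul_circleMap (hρ : 0 ≤ ρ) (hρ1 : ρ ≤ 1) {θ : ℝ}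
    (hθ : θ ∈ Icc (-π) π) : |θ| / π ≤ ‖1 - ρ * circleMap 0 1 θ‖ := by
  set w := circleMap 0 1 θ with hw
  have hw1 : ‖w‖ = 1 := by simp [hw]
  have h1 : ‖1 - w‖ ≤ 2 * ‖1 - ρ * w‖ := by
    have h2 : (1 : ℂ) - w = (1 - ρ * w) - ((1 - ρ : ℝ) : ℂ) * w := by push_cast; ring
    have h3 : ‖1 - w‖ ≤ ‖1 - ρ * w‖ + (1 - ρ) := by
      rw [h2]
      refine (norm_sub_le _ _).trans_eq ?_
      rw [norm_mul, hw1, Complex.norm_real, Real.norm_of_nonneg (by linarith), mul_one]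
    linarith [sub_le_norm_one_sub_mul hρ hw1.le]
  have h4 : ‖1 - w‖ = 2 * |sin (θ / 2)| := by
    rw [norm_sub_rev, hw, circleMap, zero_add, Complex.ofReal_one, one_mul, mul_comm,
      Complex.norm_exp_I_mul_ofReal_sub_one, norm_mul, Real.norm_ofNat, Real.norm_eq_abs]
  have h5 : |θ| / π ≤ |sin (θ / 2)| := by
    have := Real.mul_abs_le_abs_sin (x := θ / 2) (by
      rw [abs_div, abs_two]
      have := abs_le.2 hθ
      linarith)
    rw [abs_div, abs_two] at this
    calc |θ| / π = 2 / π * (|θ| / 2) := by ring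
      _ ≤ _ := this
  linarith

lemma dbar_comp_of_hasDerivAt {F φ : ℂ → ℂ} {φ' : ℂ} (hφ : HasDerivAt φ φ' w)
    (hF : DifferentiableAt ℝ F (φ w)) :
    dbar (F ∘ φ) w = starRingEnd ℂ φ' * dbar F (φ w) := by
  have h1 : HasFDerivAt (F ∘ φ) ((fderiv ℝ F (φ w)).comp
      ((ContinuousLinearMap.toSpanSingleton ℂ φ').restrictScalars ℝ)) w :=
    hF.hasFDerivAt.comp w (hφ.hasFDerivAt.restrictScalars ℝ)
  have h2 := two_mul_conj_mul_dbar F (φ w) φ'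
  have h3 : dbar (F ∘ φ) w = (1 / 2 : ℂ) * (2 * starRingEnd ℂ φ' * dbar F (φ w)) := by
    rw [dbar, h1.fderiv, h2]
    simp [mul_comm]
  rw [h3]
  ring

end diskMap

lemma integral_inv_sq_norm_one_sub_mul {a : ℝ} (ha : 0 ≤ a) (ha1 : a < 1) :
    ∫ θ in -π..π, (1 - a ^ 2) / ‖1 - a * circleMap 0 1 θ‖ ^ 2 = 2 * π := by
  have h := DiffContOnCl.circleAverage_poissonKernel_smul' (f := fun _ => (1 : ℂ)) (c := 0)
    (R := 1) (w := (a : ℂ)) diffContOnCl_const (by simpa [abs_of_nonneg ha] using ha1)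
  have hk : ∀ θ, ((‖circleMap 0 1 θ - 0‖ ^ 2 - ‖(a : ℂ) - 0‖ ^ 2) /
      ‖circleMap 0 1 θ - 0 - ((a : ℂ) - 0)‖ ^ 2) • (1 : ℂ) =
        (((1 - a ^ 2) / ‖1 - a * circleMap 0 1 θ‖ ^ 2 : ℝ) : ℂ) := by
    intro θ
    have h1 := sq_norm_one_sub_mul_sub a (circleMap 0 1 θ)
    have h2 : ‖circleMap 0 1 θ‖ = 1 := by simp
    rw [h2, norm_sub_rev (a : ℂ)] at h1
    rw [Complex.real_smul, mul_one, sub_zero, sub_zero, h2, Complex.norm_real,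
      Real.norm_of_nonneg ha, one_pow,
      show ‖circleMap 0 1 θ - a‖ ^ 2 = ‖1 - a * circleMap 0 1 θ‖ ^ 2 by linarith]
  rw [circleAverage] at h
  simp_rw [hk] at h
  rw [intervalIntegral.integral_ofReal, Complex.real_smul, ← Complex.ofReal_mul,
    Complex.ofReal_eq_one] at h
  have hper : Function.Periodic
      (fun θ => (1 - a ^ 2) / ‖1 - a * circleMap 0 1 θ‖ ^ 2) (2 * π) := fun θ => by
    simp only [periodic_circleMap 0 1 θ]
  have h3 := hper.intervalIntegral_add_eq (-π) 0
  rw [show -π + 2 * π = π by ring, zero_add] at h3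
  rw [h3]
  have := pi_pos
  field_simp at h
  linarith

/-- Mean of a majorant along the images of the unit circle under disk automorphisms. -/
lemma IsMajorant.integral_div_max_le {ω : ℝ → ℝ} (hω : IsMajorant ω) {M : ℝ}
    (hM : ∀ l ∈ Ioc (0 : ℝ) π, l * (∫ t in l..π, ω t / t ^ 2) ≤ M * ω l)
    (hM0 : 0 < M) {d : ℝ} (hd : 0 < d) (hd1 : d ≤ 1) :
    ∫ θ in -π..π, ω (d / max d |θ|) ≤ 2 * (1 + π * M) * ω d := by
  have hπ := pi_pos
  have hπ3 := pi_gt_three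
  have hdπ : d ≤ π := by linarith
  have hmax : ∀ θ : ℝ, 0 < max d |θ| := fun θ => lt_max_of_lt_left hd
  have hcont : Continuous fun θ : ℝ => ω (d / max d |θ|) := by
    refine hω.continuousOn.comp_continuous ?_ fun θ => mem_Ici.2 (div_nonneg hd.le (hmax θ).le)
    exact continuous_const.div (by fun_prop) fun θ => (hmax θ).ne'
  have hii : ∀ a b : ℝ, IntervalIntegrable (fun θ : ℝ => ω (d / max d |θ|)) volume a b := fun a b =>
    hcont.intervalIntegrable a b
  have hneg : ∫ θ in -π..0, ω (d / max d |θ|) = ∫ θ in 0..π, ω (d / max d |θ|) := by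
    have := intervalIntegral.integral_comp_neg (a := 0) (b := π) fun θ : ℝ => ω (d / max d |θ|)
    simp only [abs_neg, neg_zero] at this
    exact this.symm
  have hsmall : ∫ θ in 0..d, ω (d / max d |θ|) ≤ ω d := by
    have h1 : ∫ θ in 0..d, ω (d / max d |θ|) = ∫ θ in 0..d, ω 1 := by
      refine intervalIntegral.integral_congr fun θ hθ => ?_
      rw [uIcc_of_le hd.le] at hθ
      rw [abs_of_nonneg hθ.1, max_eq_left hθ.2, div_self hd.ne']
    rw [h1, intervalIntegral.integral_const, sub_zero, smul_eq_mul]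
    simpa using hω.mul_le_mul_of_le hd hd1
  have hlarge : ∫ θ in d..π, ω (d / max d |θ|) ≤ π * M * ω d := by
    have hu : uIcc d π = Icc d π := uIcc_of_le hdπ
    have hsubst : (∫ θ in d..π, ((fun t => ω t / t ^ 2) ∘ fun θ => d / θ) θ * (-d / θ ^ 2)) =
        ∫ t in (d / d)..(d / π), ω t / t ^ 2 := by
      refine intervalIntegral.integral_comp_mul_deriv' ?_ ?_ ?_
      · intro θ hθ
        rw [hu] at hθ
        have h0 : θ ≠ 0 := (hd.trans_le hθ.1).ne'
        simpa using! (hasDerivAt_const θ d).div (hasDerivAt_id θ) h0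
      · rw [hu]
        refine continuousOn_const.div (by fun_prop) fun θ hθ => ?_
        have : 0 < θ := hd.trans_le hθ.1
        positivity
      · rw [hu]
        refine (hω.continuousOn_div_sq (a := d / π) (b := 1) (by positivity)).mono ?_
        rintro _ ⟨θ, hθ, rfl⟩
        have h0 : 0 < θ := hd.trans_le hθ.1
        exact ⟨div_le_div_of_nonneg_left hd.le h0 hθ.2, (div_le_one h0).2 hθ.1⟩
    have h1 : ∫ θ in d..π, ω (d / max d |θ|) = d * ∫ t in (d / π)..1, ω t / t ^ 2 := by
      rw [div_self hd.ne'] at hsubst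
      rw [intervalIntegral.integral_symm 1 (d / π), ← hsubst, ← intervalIntegral.integral_neg,
        ← intervalIntegral.integral_const_mul]
      refine intervalIntegral.integral_congr fun θ hθ => ?_
      rw [hu] at hθ
      have h0 : 0 < θ := hd.trans_le hθ.1
      simp only [Function.comp_apply]
      rw [abs_of_pos h0, max_eq_right hθ.1]
      field_simp
    have hdp : 0 < d / π := by positivity
    have hdp' : d / π ≤ d := div_le_self hd.le (by linarith)
    have h2 := hM (d / π) ⟨hdp, hdp'.trans hdπ⟩
    have h3 := hω.integral_div_sq_mono hdp (hdp'.trans hd1) (by linarith : (1 : ℝ) ≤ π)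
    have h4 := hω.mono hdp.le hdp'
    rw [h1]
    calc d * ∫ t in (d / π)..1, ω t / t ^ 2 ≤ d * ∫ t in (d / π)..π, ω t / t ^ 2 := by gcongr
      _ = π * (d / π * ∫ t in (d / π)..π, ω t / t ^ 2) := by field_simp
      _ ≤ π * (M * ω d) :=
        mul_le_mul_of_nonneg_left (h2.trans (mul_le_mul_of_nonneg_left h4 hM0.le)) hπ.le
      _ = _ := by ring
  rw [← intervalIntegral.integral_add_adjacent_intervals (hii (-π) 0) (hii 0 π), hneg,
    ← intervalIntegral.integral_add_adjacent_intervals (hii 0 d) (hii d π)]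
  linarith

section boundary

variable {F : ℂ → ℂ} {B : ℝ}

lemma norm_integral_comp_diskMap_sub_le (hF : ContDiffOn ℝ 1 F (ball 0 1))
    (hFc : ContinuousOn F (closedBall 0 1)) (hB : ∀ z ∈ ball (0 : ℂ) 1, ‖dbar F z‖ ≤ B)
    {ζ : ℂ} (hζ : ‖ζ‖ = 1) {ρ : ℝ} (hρ : 0 ≤ ρ) (hρ1 : ρ < 1) :
    ‖(∫ θ in -π..π, F (diskMap ζ ρ (circleMap 0 1 θ))) - 2 * π * F (ρ * ζ)‖ ≤
      16 * π * B * (1 - ρ) * log (π / (1 - ρ)) := by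
  have hπ := pi_pos
  have hπ3 := pi_gt_three
  have hB0 : 0 ≤ B := (norm_nonneg _).trans (hB 0 (mem_ball_self one_pos))
  set d := 1 - ρ with hd
  have hd0 : 0 < d := by linarith
  set φ := diskMap ζ ρ with hφ
  have hφmem : ∀ w ∈ ball (0 : ℂ) 1, φ w ∈ ball (0 : ℂ) 1 := fun w hw =>
    mem_ball_zero_iff.2 (norm_diskMap_lt hζ hρ hρ1 (mem_ball_zero_iff.1 hw))
  have hφmem' : ∀ w ∈ closedBall (0 : ℂ) 1, φ w ∈ closedBall (0 : ℂ) 1 := fun w hw =>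
    mem_closedBall_zero_iff.2 (norm_diskMap_le hζ hρ hρ1 (mem_closedBall_zero_iff.1 hw))
  have hφc : ContinuousOn φ (closedBall 0 1) := fun w hw =>
    (hasDerivAt_diskMap ζ hρ hρ1 (mem_closedBall_zero_iff.1 hw)).continuousAt.continuousWithinAt
  have hφd : ContDiffOn ℝ 1 φ (ball 0 1) := by
    have h : DifferentiableOn ℂ φ (ball 0 1) := fun w hw =>
      (hasDerivAt_diskMap ζ hρ hρ1
        (mem_ball_zero_iff.1 hw).le).differentiableAt.differentiableWithinAt
    exact (h.contDiffOn isOpen_ball).restrict_scalars ℝ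
  have hmain := norm_integral_circleMap_sub_le (F := F ∘ φ) one_pos (hF.comp hφd hφmem)
    (hFc.comp hφc hφmem') (G := fun r => -(16 * π * B * d * log (1 + d - r)))
    (G' := fun r => 16 * π * B * d / (1 + d - r)) ?_ ?_
  · simp only [Function.comp_apply, hφ, diskMap_zero] at hmain
    refine hmain.trans ?_
    have h1 : log (1 + d) ≤ log π := log_le_log (by linarith) (by linarith)
    rw [log_div hπ.ne' hd0.ne', show 1 + d - 1 = d by ring, sub_zero]
    have : 0 ≤ 16 * π * B * d := by positivity
    nlinarith
  · intro r hr
    have h0 : 1 + d - r ≠ 0 := by linarith [hr.2]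
    refine ((((hasDerivAt_id r).const_sub (1 + d)).log h0).const_mul
      (16 * π * B * d)).neg.congr_deriv ?_
    simp only [id]
    ring
  · intro r hr
    have hcm : ∀ θ, circleMap 0 r θ ∈ ball (0 : ℂ) 1 := circleMap_mem_ball' hr.1.le hr.2
    set a := ρ * r with ha
    have ha0 : 0 ≤ a := mul_nonneg hρ hr.1.le
    have ha1 : a < 1 := by nlinarith [hr.1, hr.2]
    have hcirc : ∀ θ, (ρ : ℂ) * circleMap 0 r θ = a * circleMap 0 1 θ := fun θ => by
      simp only [circleMap, ha]
      push_cast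
      ring
    have hden : ∀ θ, 0 < ‖1 - a * circleMap 0 1 θ‖ := fun θ =>
      norm_pos_iff.2 (one_sub_mul_ne_zero ha0 ha1 (by simp))
    have hle : ∀ θ, 2 * ‖dbar (F ∘ φ) (circleMap 0 r θ)‖ ≤
        2 * B * (1 - ρ ^ 2) / (1 - a ^ 2) *
          ((1 - a ^ 2) / ‖1 - a * circleMap 0 1 θ‖ ^ 2) := by
      intro θ
      have hm := hcm θ
      have hder := hasDerivAt_diskMap ζ hρ hρ1 (mem_ball_zero_iff.1 hm).le
      rw [dbar_comp_of_hasDerivAt hder ((hF.differentiableOn one_ne_zero).differentiableAt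
        (isOpen_ball.mem_nhds (hφmem _ hm))), norm_mul, RCLike.norm_conj, norm_div, norm_mul,
        norm_neg, hζ, one_mul, norm_pow, hcirc]
      have h1 : ‖(1 - ρ ^ 2 : ℂ)‖ = 1 - ρ ^ 2 := by
        rw [← Complex.ofReal_pow, ← Complex.ofReal_one, ← Complex.ofReal_sub, Complex.norm_real,
          Real.norm_of_nonneg (by nlinarith)]
      rw [h1]
      have h2 : 0 < 1 - a ^ 2 := by nlinarith
      have h3 := hden θ
      have h4 : 2 * B * (1 - ρ ^ 2) / (1 - a ^ 2) *
          ((1 - a ^ 2) / ‖1 - a * circleMap 0 1 θ‖ ^ 2) =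
          2 * ((1 - ρ ^ 2) / ‖1 - a * circleMap 0 1 θ‖ ^ 2 * B) := by
        field_simp
      rw [h4]
      have h5 : 0 ≤ 1 - ρ ^ 2 := by nlinarith
      gcongr
      exact hB _ (hφmem _ hm)
    have hc1 := continuous_circleMap 0 1
    have hFφ : ContinuousOn (dbar (F ∘ φ)) (ball 0 1) :=
      continuousOn_dbar isOpen_ball (hF.comp hφd hφmem)
    have hker : Continuous fun θ => (1 - a ^ 2) / ‖1 - a * circleMap 0 1 θ‖ ^ 2 :=
      continuous_const.div (by fun_prop) fun θ => (pow_pos (hden θ) 2).ne'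
    have hint := intervalIntegral.integral_mono_on (μ := volume) (a := -π) (b := π) (by linarith)
      (Continuous.intervalIntegrable
        ((hFφ.comp_continuous (continuous_circleMap 0 r) hcm).norm.const_mul 2) _ _)
      ((hker.const_mul (2 * B * (1 - ρ ^ 2) / (1 - a ^ 2))).intervalIntegrable _ _)
      fun θ _ => hle θ
    refine hint.trans ?_
    rw [intervalIntegral.integral_const_mul, integral_inv_sq_norm_one_sub_mul ha0 ha1,
      div_mul_eq_mul_div, div_le_div_iff₀ (by nlinarith) (by linarith [hr.2])]
    have h6 : 1 + d - r ≤ 2 * (1 - a ^ 2) := by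
      have : 1 - r ≤ 1 - a := by nlinarith [hr.1]
      have : d ≤ 1 - a := by nlinarith [hr.2]
      nlinarith
    have h7 : 1 - ρ ^ 2 ≤ 2 * d := by nlinarith
    have h8 : (1 - ρ ^ 2) * (1 + d - r) ≤ 2 * d * (2 * (1 - a ^ 2)) :=
      mul_le_mul h7 h6 (by linarith [hr.2]) (by linarith)
    have h9 : 0 ≤ 4 * π * B := by positivity
    nlinarith [mul_le_mul_of_nonneg_left h8 h9]

/-- The radial modulus of continuity at the boundary. -/
lemma exists_norm_sub_boundary_le {ω : ℝ → ℝ} (hω : IsMajorant ω)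
    (hHL : HardyLittlewoodCondition ω) (hF : ContDiffOn ℝ 1 F (ball 0 1))
    (hFc : ContinuousOn F (closedBall 0 1)) (hB : ∀ z ∈ ball (0 : ℂ) 1, ‖dbar F z‖ ≤ B)
    (hL : F ∈ lipschitzSpace ω (sphere 0 1)) :
    ∃ C > 0, ∀ ζ : ℂ, ‖ζ‖ = 1 → ∀ ρ : ℝ, 0 ≤ ρ → ρ < 1 →
      ‖F (ρ * ζ) - F ζ‖ ≤ C * ω (1 - ρ) := by
  obtain ⟨M, hM0, hM⟩ := hHL
  obtain ⟨N, hN0, hN⟩ := hL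
  have hπ := pi_pos
  have hπ3 := pi_gt_three
  have hB0 : 0 ≤ B := (norm_nonneg _).trans (hB 0 (mem_ball_self one_pos))
  have hωπ := hω.pos π hπ
  set C₁ := 16 * π * B * (π * M / ω π) with hC₁
  set C₂ := N * (2 * π) * (2 * (1 + π * M)) with hC₂
  have hC₁0 : 0 ≤ C₁ := by positivity
  have hC₂0 : 0 < C₂ := by positivity
  refine ⟨C₁ + C₂, by positivity, fun ζ hζ ρ hρ hρ1 => ?_⟩
  set d := 1 - ρ with hd
  have hd0 : 0 < d := by linarith
  have hd1 : d ≤ 1 := by linarith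
  have hωd := hω.pos d hd0
  have h1 : ‖(∫ θ in -π..π, F (diskMap ζ ρ (circleMap 0 1 θ))) - 2 * π * F (ρ * ζ)‖ ≤
      C₁ * ω d := by
    refine (norm_integral_comp_diskMap_sub_le hF hFc hB hζ hρ hρ1).trans ?_
    have h2 := hω.mul_log_mul_le hM (θ := d / π) (r := π) (by positivity)
      ((div_le_one hπ).2 (by linarith)) hπ le_rfl
    rw [one_div_div, div_mul_cancel₀ _ hπ.ne'] at h2
    have h3 : d * log (π / d) ≤ π * M / ω π * ω d := by
      rw [div_mul_eq_mul_div, le_div_iff₀ hωπ]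
      calc d * log (π / d) * ω π = π * (d / π * log (π / d) * ω π) := by field_simp
        _ ≤ π * (M * ω d) := by gcongr
        _ = _ := by ring
    calc 16 * π * B * d * log (π / d) = 16 * π * B * (d * log (π / d)) := by ring
      _ ≤ 16 * π * B * (π * M / ω π * ω d) := by gcongr
      _ = _ := by rw [hC₁]; ring
  have h2 : ‖(∫ θ in -π..π, F (diskMap ζ ρ (circleMap 0 1 θ))) - 2 * π * F ζ‖ ≤ C₂ * ω d := by
    have hmem : ∀ θ, ‖diskMap ζ ρ (circleMap 0 1 θ)‖ = 1 := fun θ =>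
      norm_diskMap_eq hζ hρ hρ1 (by simp)
    have hφc : Continuous fun θ => diskMap ζ ρ (circleMap 0 1 θ) := by
      have hc1 := continuous_circleMap 0 1
      exact continuous_const.mul (Continuous.div (by fun_prop) (by fun_prop) fun θ =>
        one_sub_mul_ne_zero hρ hρ1 (by simp))
    have hFφ : Continuous fun θ => F (diskMap ζ ρ (circleMap 0 1 θ)) :=
      hFc.comp_continuous hφc fun θ => mem_closedBall_zero_iff.2 (hmem θ).le
    have he : (∫ θ in -π..π, F (diskMap ζ ρ (circleMap 0 1 θ))) - 2 * π * F ζ =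
        ∫ θ in -π..π, (F (diskMap ζ ρ (circleMap 0 1 θ)) - F ζ) := by
      rw [intervalIntegral.integral_sub (hFφ.intervalIntegrable _ _) intervalIntegrable_const,
        intervalIntegral.integral_const, Complex.real_smul]
      push_cast
      ring
    have hmax : ∀ θ : ℝ, 0 < max d |θ| := fun θ => lt_max_of_lt_left hd0
    have hcont : Continuous fun θ : ℝ => ω (d / max d |θ|) := by
      refine hω.continuousOn.comp_continuous ?_ fun θ =>
        mem_Ici.2 (div_nonneg hd0.le (hmax θ).le)
      exact continuous_const.div (by fun_prop) fun θ => (hmax θ).ne'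
    rw [he]
    refine (intervalIntegral.norm_integral_le_of_norm_le (by linarith) (ae_of_all _ fun θ hθ => ?_)
      ((hcont.const_mul (N * (2 * π))).intervalIntegrable _ _)).trans ?_
    · have hθ' : θ ∈ Icc (-π) π := Ioc_subset_Icc_self hθ
      refine (hN _ (mem_sphere_zero_iff_norm.2 (hmem θ)) _
        (mem_sphere_zero_iff_norm.2 hζ)).trans ?_
      rw [mul_assoc]
      gcongr
      refine le_trans (hω.mono (norm_nonneg _) ?_) (hω.map_mul_le (by linarith)
        (div_nonneg hd0.le (hmax θ).le))
      have hw : ‖circleMap 0 1 θ‖ ≤ 1 := by simp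
      refine (norm_diskMap_sub_le hζ hρ hρ1 hw).trans ?_
      have h3 : max d |θ| / π ≤ ‖1 - ρ * circleMap 0 1 θ‖ := by
        rw [div_le_iff₀ hπ]
        refine max_le ?_ ?_
        · have := sub_le_norm_one_sub_mul hρ hw
          nlinarith
        · exact (div_le_iff₀ hπ).1 (abs_div_pi_le_norm_one_sub_mul_circleMap hρ hρ1.le hθ')
      have h4 := hmax θ
      calc 2 * (1 - ρ) / ‖1 - ρ * circleMap 0 1 θ‖ ≤ 2 * d / (max d |θ| / π) := by
            gcongr
        _ = _ := by field_simp
    · rw [intervalIntegral.integral_const_mul, hC₂, mul_assoc (N * (2 * π))]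
      gcongr
      exact hω.integral_div_max_le hM hM0 hd0 hd1
  set I := ∫ θ in -π..π, F (diskMap ζ ρ (circleMap 0 1 θ))
  have h3 : ‖(2 * π : ℂ) * (F (ρ * ζ) - F ζ)‖ ≤ (C₁ + C₂) * ω d := by
    have : (2 * π : ℂ) * (F (ρ * ζ) - F ζ) = (I - 2 * π * F ζ) - (I - 2 * π * F (ρ * ζ)) := by ring
    rw [this]
    refine (norm_sub_le _ _).trans ?_
    linarith
  rw [norm_mul, norm_mul, Complex.norm_ofNat, Complex.norm_real, Real.norm_of_nonneg hπ.le] at h3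
  nlinarith [norm_nonneg (F (ρ * ζ) - F ζ)]

end boundary

lemma exists_norm_eq_one_and_eq_mul (z : ℂ) : ∃ ζ : ℂ, ‖ζ‖ = 1 ∧ z = ‖z‖ * ζ := by
  refine ⟨Complex.exp (z.arg * Complex.I), Complex.norm_exp_ofReal_mul_I _, ?_⟩
  exact (Complex.norm_mul_exp_arg_mul_I z).symm

section

variable {F : ℂ → ℂ} {B : ℝ} {ω : ℝ → ℝ}

lemma exists_norm_sub_le_of_near_boundary (hω : IsMajorant ω)
    (hHL : HardyLittlewoodCondition ω) (hF : ContDiffOn ℝ 1 F (ball 0 1))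
    (hFc : ContinuousOn F (closedBall 0 1)) (hB : ∀ z ∈ ball (0 : ℂ) 1, ‖dbar F z‖ ≤ B)
    (hL : F ∈ lipschitzSpace ω (sphere 0 1)) :
    ∃ C > 0, ∀ z ∈ ball (0 : ℂ) 1, ∀ w ∈ ball (0 : ℂ) 1, ∀ t : ℝ, 0 < t → 1 - ‖z‖ ≤ 2 * t →
      dist z w ≤ t → ‖F w - F z‖ ≤ C * ω t := by
  obtain ⟨C, hC0, hC⟩ := exists_norm_sub_boundary_le hω hHL hF hFc hB hL
  obtain ⟨N, hN0, hN⟩ := hL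
  refine ⟨5 * C + 6 * N, by positivity, fun z hz w hw t ht hzt hzw => ?_⟩
  rw [mem_ball_zero_iff] at hz hw
  obtain ⟨ζ, hζ, hzζ⟩ := exists_norm_eq_one_and_eq_mul z
  obtain ⟨ξ, hξ, hwξ⟩ := exists_norm_eq_one_and_eq_mul w
  have hnear : ∀ {x η : ℂ}, ‖x‖ < 1 → ‖η‖ = 1 → x = ‖x‖ * η → ‖x - η‖ = 1 - ‖x‖ := by
    intro x η hx hη he
    have h : x - η = -(((1 - ‖x‖ : ℝ) : ℂ) * η) := by
      conv_lhs => rw [he]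
      push_cast
      ring
    rw [h, norm_neg, norm_mul, hη, mul_one, Complex.norm_real, Real.norm_of_nonneg (by linarith)]
  have hwt : 1 - ‖w‖ ≤ 3 * t := by
    have := norm_sub_norm_le z w
    rw [← dist_eq_norm] at this
    linarith
  have h1 : ‖F z - F ζ‖ ≤ C * (2 * ω t) := by
    have := hC ζ hζ ‖z‖ (norm_nonneg z) hz
    rw [← hzζ] at this
    refine this.trans ?_
    gcongr
    exact (hω.mono (by linarith) hzt).trans (hω.map_mul_le (by norm_num) ht.le)
  have h2 : ‖F w - F ξ‖ ≤ C * (3 * ω t) := by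
    have := hC ξ hξ ‖w‖ (norm_nonneg w) hw
    rw [← hwξ] at this
    refine this.trans ?_
    gcongr
    exact (hω.mono (by linarith) hwt).trans (hω.map_mul_le (by norm_num) ht.le)
  have h3 : ‖F ξ - F ζ‖ ≤ N * (6 * ω t) := by
    refine (hN ξ (mem_sphere_zero_iff_norm.2 hξ) ζ (mem_sphere_zero_iff_norm.2 hζ)).trans ?_
    gcongr
    refine (hω.mono (norm_nonneg _) ?_).trans (hω.map_mul_le (by norm_num) ht.le)
    have e : ξ - ζ = (z - ζ) - (w - ξ) - (z - w) := by ring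
    have e1 := norm_sub_le ((z - ζ) - (w - ξ)) (z - w)
    have e2 := norm_sub_le (z - ζ) (w - ξ)
    rw [e]
    rw [hnear hz hζ hzζ, hnear hw hξ hwξ] at e2
    rw [← dist_eq_norm z w] at e1
    linarith
  have e : F w - F z = (F w - F ξ) + (F ξ - F ζ) - (F z - F ζ) := by ring
  rw [e]
  have e1 := norm_sub_le ((F w - F ξ) + (F ξ - F ζ)) (F z - F ζ)
  have e2 := norm_add_le (F w - F ξ) (F ξ - F ζ)
  linarith

/-- If `F` is continuous on the closed unit disk, its values on the circle have modulus of
continuity `ω`, where `ω` satisfies the Hardy–Littlewood condition, and `dbar F` is bounded, then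
`ω` controls `F` on the whole disk. -/
theorem mem_lipschitzSpace_ball_of_dbar_bound (hω : IsMajorant ω)
    (hHL : HardyLittlewoodCondition ω) (hF : ContDiffOn ℝ 1 F (ball 0 1))
    (hFc : ContinuousOn F (closedBall 0 1)) (hB : ∀ z ∈ ball (0 : ℂ) 1, ‖dbar F z‖ ≤ B)
    (hL : F ∈ lipschitzSpace ω (sphere 0 1)) : F ∈ lipschitzSpace ω (ball 0 1) := by
  obtain ⟨C, hC0, hC⟩ := exists_norm_sub_le_of_near_boundary hω hHL hF hFc hB hL
  obtain ⟨M, hM0, hM⟩ := hHL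
  have hπ3 := pi_gt_three
  have hB0 : 0 ≤ B := (norm_nonneg _).trans (hB 0 (mem_ball_self one_pos))
  have hω1 := hω.pos 1 one_pos
  set θ := exp (-(32 * M + 3)) with hθ
  have hθ0 : 0 < θ := exp_pos _
  have hθ4 : θ ≤ 1 / 4 := by
    rw [hθ, exp_neg, inv_eq_one_div]
    refine one_div_le_one_div_of_le (by norm_num) ?_
    linarith [add_one_le_exp (32 * M + 3)]
  have hscale : ∀ r, 0 < r → r ≤ 1 → 32 * θ * ω r ≤ ω (θ * r) := by
    intro r hr hr1
    have h := hω.mul_log_mul_le hM hθ0 (by linarith) hr (by linarith)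
    rw [one_div, log_inv, hθ, log_exp, ← hθ, neg_neg] at h
    have h1 := hω.pos r hr
    have h2 : M * (32 * θ * ω r) ≤ M * ω (θ * r) := by
      have : 0 ≤ 3 * θ * ω r := by positivity
      linarith
    exact le_of_mul_le_mul_left h2 hM0
  set K := C + 2 * B / (θ * ω 1) with hK
  have hCK : C ≤ K := le_add_of_nonneg_right (by positivity)
  have hK0 : 0 < K := hC0.trans_le hCK
  have hosc : ∀ z ∈ ball (0 : ℂ) 1, ∀ k : ℕ, ∀ x, dist z x ≤ θ ^ k * (1 - ‖z‖) / 2 →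
      ‖F x - F z‖ ≤ K * ω (θ ^ k * (1 - ‖z‖)) := by
    intro z hz
    have hz1 := mem_ball_zero_iff.1 hz
    set d := 1 - ‖z‖ with hd
    have hd0 : 0 < d := by linarith
    have hd1 : d ≤ 1 := by linarith [norm_nonneg z]
    intro k
    induction k with
    | zero =>
      intro x hx
      rw [pow_zero, one_mul] at hx ⊢
      have hx1 : x ∈ ball (0 : ℂ) 1 := by
        rw [mem_ball_zero_iff]
        have := norm_sub_norm_le x z
        rw [← dist_eq_norm, dist_comm] at this
        linarith
      refine (hC z hz x hx1 d hd0 (by linarith) (by linarith)).trans ?_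
      have := hω.pos d hd0
      gcongr
    | succ k ih =>
      intro x hx
      set r := θ ^ k * d with hr
      have hr0 : 0 < r := by positivity
      have hrd : r ≤ d := mul_le_of_le_one_left hd0.le (pow_le_one₀ hθ0.le (by linarith))
      have hrs : θ ^ (k + 1) * d = θ * r := by rw [hr]; ring
      rw [hrs] at hx ⊢
      have hsub : ball z (r / 2) ⊆ ball (0 : ℂ) 1 := by
        refine ball_subset_ball' ?_
        rw [dist_zero_right]
        linarith
      have h1 := norm_sub_le_of_dbar_bound (w := x) (R := r / 2) (S := K * ω r) (by positivity)
        (hF.mono hsub) (fun y hy => hB y (hsub hy))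
        (fun y hy => ih y (by rw [dist_comm]; exact (mem_ball.1 hy).le)) (by nlinarith)
      have h2 : 16 * (K * ω r) * dist z x / (r / 2) ≤ K / 2 * ω (θ * r) := by
        have hωr := hω.pos r hr0
        calc 16 * (K * ω r) * dist z x / (r / 2) ≤ 16 * (K * ω r) * (θ * r / 2) / (r / 2) := by
              gcongr
          _ = K / 2 * (32 * θ * ω r) := by field_simp; ring
          _ ≤ _ := by
            gcongr
            exact hscale r hr0 (hrd.trans hd1)
      have h3 : 2 * B * (r / 2) ≤ K / 2 * ω (θ * r) := by
        have hle : θ * r ≤ 1 := by nlinarith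
        have h4 := hω.mul_le_mul_of_le (mul_pos hθ0 hr0) hle
        have h5 : B / (θ * ω 1) ≤ K / 2 := by
          rw [hK]
          have : 2 * B / (θ * ω 1) = 2 * (B / (θ * ω 1)) := by ring
          linarith
        calc 2 * B * (r / 2) = B / (θ * ω 1) * (θ * r * ω 1) := by field_simp
          _ ≤ B / (θ * ω 1) * (1 * ω (θ * r)) := by gcongr
          _ ≤ _ := by
            rw [one_mul]
            have := hω.pos _ (mul_pos hθ0 hr0)
            gcongr
      linarith
  refine ⟨K * (2 / θ), by positivity, fun w hw z hz => ?_⟩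
  rw [← dist_eq_norm w z, dist_comm]
  have hz1 := mem_ball_zero_iff.1 hz
  rcases eq_or_ne z w with rfl | hne
  · simp [hω.map_zero]
  have hδ : 0 < dist z w := dist_pos.2 hne
  have hωδ := hω.pos _ hδ
  have h2θ : 1 ≤ 2 / θ := (one_le_div hθ0).2 (by linarith)
  set d := 1 - ‖z‖ with hd
  have hd0 : 0 < d := by linarith
  rcases le_or_gt d (2 * dist z w) with h | h
  · refine (hC z hz w hw _ hδ h le_rfl).trans ?_
    gcongr
    exact hCK.trans (le_mul_of_one_le_right hK0.le h2θ)
  · obtain ⟨n, hn1, hn2⟩ := exists_nat_pow_near_of_lt_one (x := 2 * dist z w / d) (y := θ)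
      (by positivity) ((div_le_one hd0).2 h.le) hθ0 (by linarith)
    rw [div_le_iff₀ hd0] at hn2
    rw [lt_div_iff₀ hd0] at hn1
    refine (hosc z hz n w (by linarith)).trans ?_
    rw [mul_assoc]
    gcongr
    refine (hω.mono (by positivity) ?_).trans (hω.map_mul_le h2θ hδ.le)
    rw [div_mul_eq_mul_div, le_div_iff₀ hθ0]
    calc θ ^ n * d * θ = θ ^ (n + 1) * d := by ring
      _ ≤ _ := hn1.le

end

lemma exists_bound_of_hasBoundaryValues {h b : ℂ → ℂ} (hc : ContinuousOn h (ball 0 1))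
    (hb : HasBoundaryValues h b) : ∃ B, ∀ z ∈ ball (0 : ℂ) 1, ‖h z‖ ≤ B := by
  have key : ∃ B, ∀ z ∈ closedBall (0 : ℂ) 1 ∩ ball 0 1, ‖h z‖ ≤ B := by
    refine (isCompact_closedBall (0 : ℂ) 1).induction_on
      (p := fun S => ∃ B, ∀ z ∈ S ∩ ball 0 1, ‖h z‖ ≤ B) ⟨0, by simp⟩ ?_ ?_ ?_
    · rintro S T hST ⟨B, hB⟩
      exact ⟨B, fun z hz => hB z ⟨hST hz.1, hz.2⟩⟩
    · rintro S T ⟨B, hB⟩ ⟨B', hB'⟩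
      refine ⟨max B B', ?_⟩
      rintro z ⟨hz | hz, hz1⟩
      · exact (hB z ⟨hz, hz1⟩).trans (le_max_left _ _)
      · exact (hB' z ⟨hz, hz1⟩).trans (le_max_right _ _)
    · intro ζ hζ
      have ht : ∃ a, Tendsto h (𝓝[ball 0 1] ζ) (𝓝 a) := by
        by_cases h1 : ζ ∈ ball (0 : ℂ) 1
        · exact ⟨_, hc ζ h1⟩
        · refine ⟨_, hb ζ (mem_sphere_zero_iff_norm.2 ?_)⟩
          rw [mem_ball_zero_iff] at h1
          exact le_antisymm (mem_closedBall_zero_iff.1 hζ) (not_lt.1 h1)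
      obtain ⟨a, ha⟩ := ht
      have hev : ∀ᶠ z in 𝓝[ball 0 1] ζ, ‖h z‖ < ‖a‖ + 1 :=
        ha.norm.eventually_lt_const (lt_add_one _)
      obtain ⟨U, hU, hUb⟩ := mem_nhdsWithin_iff_exists_mem_nhds_inter.1 hev
      exact ⟨U, mem_nhdsWithin_of_mem_nhds hU, ‖a‖ + 1, fun z hz => (hUb hz).le⟩
  obtain ⟨B, hB⟩ := key
  exact ⟨B, fun z hz => hB z ⟨ball_subset_closedBall hz, hz⟩⟩

lemma IsMajorant.continuousOn_of_mem_lipschitzSpace {ω : ℝ → ℝ} (hω : IsMajorant ω) {h : ℂ → ℂ}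
    {Ω : Set ℂ} (hh : h ∈ lipschitzSpace ω Ω) : ContinuousOn h Ω := by
  obtain ⟨M, -, hM⟩ := hh
  intro ζ hζ
  rw [ContinuousWithinAt, tendsto_iff_norm_sub_tendsto_zero]
  have h1 : Continuous fun z : ℂ => ω ‖z - ζ‖ :=
    hω.continuousOn.comp_continuous (by fun_prop) fun z => mem_Ici.2 (norm_nonneg _)
  have h2 : Tendsto (fun z : ℂ => M * ω ‖z - ζ‖) (𝓝[Ω] ζ) (𝓝 0) := by
    have := ((h1.const_mul M).tendsto ζ).mono_left (nhdsWithin_le_nhds (s := Ω))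
    simpa [hω.map_zero] using this
  refine squeeze_zero' (Eventually.of_forall fun z => norm_nonneg _) ?_ h2
  filter_upwards [self_mem_nhdsWithin] with z hz using hM z hz ζ hζ

open Classical in
lemma HasBoundaryValues.continuousOn_piecewise {h b : ℂ → ℂ} (hb : HasBoundaryValues h b)
    (hc : ContinuousOn h (ball 0 1)) (hbc : ContinuousOn b (sphere 0 1)) :
    ContinuousOn ((ball (0 : ℂ) 1).piecewise h b) (closedBall 0 1) := by
  intro ζ hζ
  have hin : EqOn ((ball (0 : ℂ) 1).piecewise h b) h (ball 0 1) := piecewise_eqOn _ _ _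
  have hout : EqOn ((ball (0 : ℂ) 1).piecewise h b) b (sphere 0 1) := fun z hz =>
    piecewise_eq_of_notMem _ _ _ fun hz' => (ne_of_lt (mem_ball.1 hz')) (mem_sphere.1 hz)
  by_cases h1 : ζ ∈ ball (0 : ℂ) 1
  · refine ContinuousAt.continuousWithinAt ?_
    exact ((hc.congr hin).continuousAt (isOpen_ball.mem_nhds h1))
  · have hs : ζ ∈ sphere (0 : ℂ) 1 := by
      rw [mem_ball, not_lt] at h1
      exact le_antisymm (mem_closedBall.1 hζ) h1
    rw [ContinuousWithinAt, hout hs, ← ball_union_sphere, nhdsWithin_union, tendsto_sup]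
    exact ⟨(hb ζ hs).congr' (eventually_nhdsWithin_of_forall fun z hz => (hin hz).symm),
      (hbc ζ hs).tendsto.congr' (eventually_nhdsWithin_of_forall fun z hz => (hout hz).symm)⟩

end Biharmonic

theorem theorem2 (ω₁ ω₂ : ℝ → ℝ)
    (hω₁ : Biharmonic.IsMajorant ω₁)
    (hω₂ : Biharmonic.IsMajorant ω₂)
    (hHL : Biharmonic.HardyLittlewoodCondition ω₂)
    (g φ φ₁ ψ f : ℂ → ℂ)
    (hg : ContinuousOn g (closedBall (0 : ℂ) 1))
    (hφ₁_def : ∀ t ∈ Icc (0 : ℝ) (2 * Real.pi),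
      φ₁ (Complex.exp (Complex.I * t)) =
        φ (Complex.exp (Complex.I * t)) * Complex.exp (-(Complex.I * t)))
    (hφ₁ : φ₁ ∈ Biharmonic.lipschitzSpace ω₁ (sphere (0 : ℂ) 1))
    (hψ : ψ ∈ Biharmonic.lipschitzSpace ω₂ (sphere (0 : ℂ) 1))
    (hf : Biharmonic.IsSolution g φ ψ f) :
    ∃ M : ℝ, 0 < M ∧ ∀ z₁ ∈ ball (0 : ℂ) 1, ∀ z₂ ∈ ball (0 : ℂ) 1,
      ‖f z₁ - f z₂‖ ≤ M * ω₁ ‖z₁ - z₂‖ + M * ω₂ ‖z₁ - z₂‖ := by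
  classical
  -- The data `g` and `φ` enter only through the boundedness of `dbar f` on the disk, which follows
  -- from the existence of its boundary values and compactness.
  have hf1 : ContDiffOn ℝ 1 f (ball 0 1) := hf.contDiffOn.of_le (by norm_num)
  obtain ⟨B, hB⟩ := Biharmonic.exists_bound_of_hasBoundaryValues
    (Biharmonic.continuousOn_dbar isOpen_ball hf1) hf.boundary_dbar
  set F := (ball (0 : ℂ) 1).piecewise f ψ with hF
  have hin : EqOn F f (ball 0 1) := piecewise_eqOn _ _ _
  have hout : EqOn F ψ (sphere 0 1) := fun z hz =>
    piecewise_eq_of_notMem _ _ _ fun hz' => (ne_of_lt (mem_ball.1 hz')) (mem_sphere.1 hz)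
  have hFB : ∀ z ∈ ball (0 : ℂ) 1, ‖Biharmonic.dbar F z‖ ≤ B := by
    intro z hz
    have : fderiv ℝ F z = fderiv ℝ f z :=
      (hin.eventuallyEq_of_mem (isOpen_ball.mem_nhds hz)).fderiv_eq
    rw [Biharmonic.dbar, this]
    exact hB z hz
  have hFL : F ∈ Biharmonic.lipschitzSpace ω₂ (sphere 0 1) := by
    obtain ⟨M, hM0, hM⟩ := hψ
    refine ⟨M, hM0, fun z₁ h₁ z₂ h₂ => ?_⟩
    rw [hout h₁, hout h₂]
    exact hM z₁ h₁ z₂ h₂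
  obtain ⟨M, hM0, hM⟩ := Biharmonic.mem_lipschitzSpace_ball_of_dbar_bound hω₂ hHL (hf1.congr hin)
    (hf.boundary_value.continuousOn_piecewise hf1.continuousOn
      (hω₂.continuousOn_of_mem_lipschitzSpace hψ)) hFB hFL
  refine ⟨M, hM0, fun z₁ h₁ z₂ h₂ => ?_⟩
  have h := hM z₁ h₁ z₂ h₂
  rw [hin h₁, hin h₂] at h
  have := mul_nonneg hM0.le (hω₁.nonneg (norm_nonneg (z₁ - z₂)))
  linarith
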